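/- **Lemma 3.32.** Let $n, r \ge 0$ be integers and let $K_1,\dots,K_r \in \mathbb{C}[[x_1,\dots,x_n]]$ be formal power series. Let $\mathcal{I}(K)$ be the ideal of $\mathbb{C}[[x_1,\dots,x_n]]$ generated by $K_1,\dots,K_r$. Then the following are equivalent: (i) the complex vector space $\mathbb{C}[[x_1,\dots,x_n]]/\mathcal{I}(K)$ is infinite-dimensional; (ii) there exists $\mu=(\mu_1,\dots,\mu_n)$ with $\mu_1,\dots,\mu_n\in\mathbb{C}[[s]]$, all with zero constant term and not all zero, such that $K_j(\mu(s)) = 0$ in $\mathbb{C}[[s]]$ for all $1\le j\le r$. -/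

import Mathlib

/-- `f(μ(s))`: the composition of a formal power series `f ∈ ℂ⟦x₁,…,xₙ⟧` with an `n`-tuple `μ` of formal
power series in one variable `s`. This is substitution of formal power series, meaningful when all the `μᵢ` have
zero constant term, the only case in which it is used. -/
noncomputable def formalComp {n : ℕ} (f : MvPowerSeries (Fin n) ℂ) (μ : Fin n → PowerSeries ℂ) :
    PowerSeries ℂ :=
  MvPowerSeries.subst μ f

/-! If the quotient is finite-dimensional, substitution of `μ` factors through it, so each `μ i` is
algebraic over `ℂ`; having zero constant term, it vanishes. Conversely, infinite dimension means
that `I` contains no power of the ideal `m` of the variables. Choose `P ⊇ I` maximal with that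
property. It is prime, and the quotient by it is finite over `k⟦x_i⟧` for any `x_i ∉ P`: a formal
curve. The integral closure of `k⟦x_i⟧` in its fraction field is Dedekind; localizing at a maximal
ideal gives a discrete valuation ring with residue field `k`, and Taylor expansion in a uniformizer
maps it to `k⟦s⟧` (`exists_taylor`, `exists_branch`, `exists_curve`). -/

open MvPowerSeries in
theorem MvPowerSeries.mem_span_X_pow {σ R : Type*} [Finite σ] [CommRing R] (k : ℕ)
    (f : MvPowerSeries σ R) (hf : ∀ d : σ →₀ ℕ, d.degree < k → coeff d f = 0) :
    f ∈ Ideal.span (Set.range (X : σ → MvPowerSeries σ R)) ^ k := by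
  classical
  have := Fintype.ofFinite σ
  induction k generalizing f with
  | zero => simp
  | succ k ih =>
    rcases isEmpty_or_nonempty σ with hσ | hσ
    · have : f = 0 := by
        ext d
        rw [Subsingleton.elim d 0]
        simpa using hf 0 (by simp)
      simp [this]
    -- Assign to each nonconstant monomial one variable dividing it; `g i` collects the monomials
    -- assigned to `i`, divided by `X i`.
    have hex : ∀ e : σ →₀ ℕ, ∃ i, e ≠ 0 → e i ≠ 0 := by
      intro e
      by_contra! h
      obtain ⟨i⟩ := hσ
      exact (h i).1 (Finsupp.ext fun j => (h j).2)
    choose h hh using hex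
    let g : σ → MvPowerSeries σ R := fun i d =>
      if h (d + Finsupp.single i 1) = i then coeff (d + Finsupp.single i 1) f else 0
    have hg : ∀ i d, coeff d (g i) =
      if h (d + Finsupp.single i 1) = i then coeff (d + Finsupp.single i 1) f else 0 :=
      fun i d => rfl
    have hsum : f = ∑ i, X i * g i := by
      ext e
      rw [map_sum]
      by_cases he : e = 0
      · subst he
        rw [hf 0 (by simp)]
        simp
      have key : ∀ i, coeff e (X i * g i) = if i = h e then coeff e f else 0 := by
        intro i
        rw [X, coeff_monomial_mul]
        by_cases hi : Finsupp.single i 1 ≤ e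
        · rw [if_pos hi, hg, tsub_add_cancel_of_le hi, one_mul]
          simp only [eq_comm]
        · rw [if_neg hi, if_neg]
          rintro rfl
          apply hi
          rw [Finsupp.single_le_iff]
          exact Nat.one_le_iff_ne_zero.2 (hh e he)
      simp [key]
    rw [hsum, pow_succ']
    refine Ideal.sum_mem _ fun i _ => Ideal.mul_mem_mul (Ideal.subset_span ⟨i, rfl⟩) (ih _ ?_)
    intro d hd
    rw [hg, hf, ite_self]
    simpa using hd

/-- Two algebra homomorphisms to `k⟦X⟧` that agree on the variables are equal. -/
theorem MvPowerSeries.algHom_powerSeries_ext {σ k : Type*} [Finite σ] [CommRing k]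
    {φ ψ : MvPowerSeries σ k →ₐ[k] PowerSeries k}
    (hφ : ∀ i, PowerSeries.constantCoeff (φ (X i)) = 0) (h : ∀ i, φ (X i) = ψ (X i)) : φ = ψ := by
  have hle : ∀ χ : MvPowerSeries σ k →ₐ[k] PowerSeries k,
      (∀ i, PowerSeries.constantCoeff (χ (X i)) = 0) → ∀ (N : ℕ) (g : MvPowerSeries σ k),
      g ∈ Ideal.span (Set.range (X : σ → MvPowerSeries σ k)) ^ N →
        (PowerSeries.X : PowerSeries k) ^ N ∣ χ g := by
    intro χ hχ N g hg
    have h1 : Ideal.span (Set.range (X : σ → MvPowerSeries σ k)) ≤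
        (Ideal.span {(PowerSeries.X : PowerSeries k)}).comap χ := by
      rw [Ideal.span_le]
      rintro _ ⟨i, rfl⟩
      simpa [Ideal.mem_span_singleton, PowerSeries.X_dvd_iff] using hχ i
    have h2 := (Ideal.pow_right_mono h1 N).trans (Ideal.le_comap_pow χ N) hg
    rwa [Ideal.mem_comap, Ideal.span_singleton_pow, Ideal.mem_span_singleton] at h2
  have hpoly : (φ.comp (MvPolynomial.coeToMvPowerSeries.algHom k)) =
      ψ.comp (MvPolynomial.coeToMvPowerSeries.algHom k) := by
    ext i : 1
    simpa using h i
  ext1 f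
  ext N
  -- Continuity is automatic: the tail lies in the power `N + 1` of the ideal of the variables, so
  -- neither map sees it in coefficient `N`.
  let p := truncTotal (N + 1) f
  have hp : φ p = ψ p := by simpa using DFunLike.congr_fun hpoly p
  have hf : f - p ∈ Ideal.span (Set.range (X : σ → MvPowerSeries σ k)) ^ (N + 1) := by
    apply mem_span_X_pow
    intro d hd
    simp [p, coeff_truncTotal _ hd]
  have h1 := PowerSeries.X_pow_dvd_iff.1 (hle φ hφ _ _ hf) N (by simp)
  have h2 := PowerSeries.X_pow_dvd_iff.1 (hle ψ (fun i => h i ▸ hφ i) _ _ hf) N (by simp)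
  rw [map_sub, map_sub, sub_eq_zero] at h1 h2
  rw [h1, h2, hp]

/-! ### Branches of one-dimensional domains -/

/-- Taylor expansion in a uniformizing parameter. -/
theorem PowerSeries.exists_taylor {k V : Type*} [Field k] [CommRing V] [IsDomain V] [Algebra k V]
    (res : V →ₐ[k] k) (π : V) (hπ : π ≠ 0) (hres : ∀ v, res v = 0 ↔ π ∣ v) :
    ∃ T : V →ₐ[k] PowerSeries k, T π = X ∧ ∀ v, constantCoeff (T v) = res v := by
  have hex : ∀ v, ∃ w, v = algebraMap k V (res v) + π * w := by
    intro v
    obtain ⟨w, hw⟩ := (hres (v - algebraMap k V (res v))).1 (by simp)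
    exact ⟨w, by rw [← hw]; ring⟩
  choose q hq using hex
  have huniq : ∀ v c w, v = algebraMap k V c + π * w → q v = w := by
    intro v c w h
    have h1 : res v = c := by rw [h]; simp [(hres π).2 dvd_rfl]
    have h2 := hq v
    rw [h1] at h2
    exact (mul_left_cancel₀ hπ (add_left_cancel (h.symm.trans h2))).symm
  have qadd : ∀ v w, q (v + w) = q v + q w := fun v w =>
    huniq _ (res v + res w) _ (by rw [map_add]; nth_rw 1 [hq v, hq w]; ring)
  -- This twisted Leibniz rule for the divided difference `q` is what makes `T` multiplicative.
  have qmul : ∀ v w, q (v * w) = q v * w + algebraMap k V (res v) * q w := fun v w =>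
    huniq _ (res v * res w) _ (by
      rw [map_mul]
      nth_rw 1 [hq v]
      rw [add_mul]
      nth_rw 1 [hq w]; ring)
  have qalg : ∀ c, q (algebraMap k V c) = 0 := fun c => huniq _ c _ (by simp)
  let T : V → PowerSeries k := fun v => PowerSeries.mk fun N => res (q^[N] v)
  have T0 : ∀ v, constantCoeff (T v) = res v := fun v => by
    simp [T, ← coeff_zero_eq_constantCoeff_apply]
  have Tsucc : ∀ v N, coeff (N + 1) (T v) = coeff N (T (q v)) := fun v N => by simp [T]
  have Tadd : ∀ v w, T (v + w) = T v + T w := by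
    intro v w
    ext N
    induction N generalizing v w with
    | zero => simp [T0]
    | succ N ih => rw [Tsucc, qadd, ih, map_add, map_add, Tsucc, Tsucc]
  have Talg : ∀ c, T (algebraMap k V c) = C c := by
    have hz : ∀ N, coeff N (T 0) = 0 := by
      intro N
      induction N with
      | zero => simp [T0]
      | succ N ih => rw [Tsucc, ← map_zero (algebraMap k V), qalg, ih]
    intro c
    ext N
    cases N with
    | zero => simp [T0]
    | succ N => simp [Tsucc, qalg, hz]
  have Tq : ∀ v, T v = C (res v) + X * T (q v) := by
    intro v
    ext N
    cases N with
    | zero => simp [T0]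
    | succ N => simp [Tsucc, coeff_succ_X_mul]
  have Tmul : ∀ v w, T (v * w) = T v * T w := by
    intro v w
    ext N
    induction N generalizing v w with
    | zero => simp [T0]
    | succ N ih =>
      have e : T v * T w = C (res v * res w) + X * (T (q v) * T w + C (res v) * T (q w)) := by
        nth_rw 1 [Tq v]
        rw [add_mul]
        nth_rw 1 [Tq w]
        rw [map_mul]; ring
      rw [e, Tsucc, qmul, Tadd, map_add, ih, ih, Talg]
      simp [coeff_succ_X_mul]
  have Tone : T 1 = 1 := by simpa using Talg 1
  refine ⟨{ toFun := T, map_one' := Tone, map_mul' := Tmul, map_add' := Tadd,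
            map_zero' := by simpa using Talg 0, commutes' := Talg }, ?_, T0⟩
  change T π = X
  have : q π = 1 := huniq _ 0 _ (by simp)
  rw [Tq, this, Tone, (hres π).2 dvd_rfl]
  simp

/-- An integral extension of `k⟦X⟧` that is a Dedekind domain has a homomorphism to `k⟦X⟧` under
which the parameter `X` goes to a nonzero nonunit. -/
theorem PowerSeries.exists_branch_of_isDedekindDomain {k B : Type*} [Field k] [IsAlgClosed k]
    [CommRing B] [IsDedekindDomain B] [Algebra k B] [Algebra (PowerSeries k) B]
    [IsScalarTower k (PowerSeries k) B] [Algebra.IsIntegral (PowerSeries k) B]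
    (hXB : algebraMap (PowerSeries k) B X ≠ 0) :
    ∃ φ : B →ₐ[k] PowerSeries k, φ (algebraMap (PowerSeries k) B X) ≠ 0 ∧
      constantCoeff (φ (algebraMap (PowerSeries k) B X)) = 0 := by
  obtain ⟨M, hM⟩ := Ideal.exists_maximal B
  have hMA : M.comap (algebraMap (PowerSeries k) B) = Ideal.span {X} := by
    rw [← maximalIdeal_eq_span_X]
    exact IsLocalRing.eq_maximalIdeal (Ideal.isMaximal_comap_of_isIntegral_of_isMaximal M)
  have hXM : algebraMap (PowerSeries k) B X ∈ M := by
    rw [← Ideal.mem_comap, hMA]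
    exact Ideal.mem_span_singleton_self _
  have hM0 : M ≠ ⊥ := by
    rintro rfl
    exact hXB hXM
  have hfac : (algebraMap (PowerSeries k) (B ⧸ M)) =
      (algebraMap k (B ⧸ M)).comp (constantCoeff (R := k)) := by
    ext a
    have h1 : a = algebraMap k (PowerSeries k) (constantCoeff a) +
        X * mk fun p => coeff (p + 1) a := by
      rw [← sub_const_eq_X_mul_shift]
      simp
    have h2 : algebraMap (PowerSeries k) (B ⧸ M) X = 0 :=
      Ideal.Quotient.eq_zero_iff_mem.2 hXM
    nth_rw 1 [h1]
    rw [map_add, map_mul, h2, zero_mul, add_zero, ← IsScalarTower.algebraMap_apply]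
    rfl
  have : Algebra.IsIntegral k (B ⧸ M) := by
    refine ⟨fun x => ?_⟩
    obtain ⟨b, rfl⟩ := Ideal.Quotient.mk_surjective x
    obtain ⟨p, hp, hpb⟩ := (Algebra.IsIntegral.isIntegral (R := PowerSeries k) b).map
      (Ideal.Quotient.mkₐ (PowerSeries k) M)
    refine ⟨p.map constantCoeff, hp.map _, ?_⟩
    rw [Polynomial.eval₂_map, ← hfac]
    exact hpb
  let e : k ≃ₐ[k] B ⧸ M :=
    AlgEquiv.ofBijective (Algebra.ofId k (B ⧸ M)) IsAlgClosed.algebraMap_bijective_of_isIntegral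
  let r : B →ₐ[k] k := AlgHom.comp (e.symm : (B ⧸ M) →ₐ[k] k) (Ideal.Quotient.mkₐ k M)
  have hr : ∀ b, r b = 0 ↔ b ∈ M := by
    intro b
    simp [r, Ideal.Quotient.eq_zero_iff_mem]
  let V := Localization.AtPrime M
  have : IsDiscreteValuationRing V :=
    IsLocalization.AtPrime.isDiscreteValuationRing_of_dedekind_domain B hM0 V
  let res : V →ₐ[k] k := IsLocalization.liftAlgHom (M := M.primeCompl) (f := r) fun y =>
    isUnit_iff_ne_zero.2 (mt (hr y).1 y.2)
  obtain ⟨π, hπ⟩ := IsDiscreteValuationRing.exists_irreducible V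
  have hres : ∀ v, res v = 0 ↔ π ∣ v := by
    intro v
    have hker : RingHom.ker res = IsLocalRing.maximalIdeal V :=
      IsLocalRing.eq_maximalIdeal (RingHom.ker_isMaximal_of_surjective res
        fun c => ⟨algebraMap k V c, res.commutes c⟩)
    rw [← RingHom.mem_ker, hker, hπ.maximalIdeal_eq, Ideal.mem_span_singleton]
  obtain ⟨T, hTπ, hT0⟩ := exists_taylor res π hπ.ne_zero hres
  refine ⟨T.comp (IsScalarTower.toAlgHom k B V), ?_, ?_⟩
  · have hne : algebraMap B V (algebraMap (PowerSeries k) B X) ≠ 0 := by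
      rwa [Ne, FaithfulSMul.algebraMap_eq_zero_iff]
    obtain ⟨m, u, hu⟩ := IsDiscreteValuationRing.eq_unit_mul_pow_irreducible hne hπ
    rw [AlgHom.comp_apply, IsScalarTower.toAlgHom_apply, hu, map_mul, map_pow, hTπ]
    exact mul_ne_zero (u.isUnit.map T).ne_zero (pow_ne_zero _ X_ne_zero)
  · rw [AlgHom.comp_apply, IsScalarTower.toAlgHom_apply, hT0]
    have : res (algebraMap B V (algebraMap (PowerSeries k) B X)) =
        r (algebraMap (PowerSeries k) B X) := by
      simp [res]
    rw [this, hr]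
    exact hXM

/-- A domain that is finite over `k⟦X⟧` and in which `X` does not vanish has a branch: a
homomorphism to `k⟦X⟧` under which the parameter `X` goes to a nonzero nonunit. -/
theorem PowerSeries.exists_branch {k D : Type*} [Field k] [IsAlgClosed k] [CharZero k] [CommRing D]
    [IsDomain D] [Algebra k D] [Algebra (PowerSeries k) D] [IsScalarTower k (PowerSeries k) D]
    [Module.Finite (PowerSeries k) D] (hX : algebraMap (PowerSeries k) D X ≠ 0) :
    ∃ φ : D →ₐ[k] PowerSeries k, φ (algebraMap (PowerSeries k) D X) ≠ 0 ∧
      constantCoeff (φ (algebraMap (PowerSeries k) D X)) = 0 := by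
  have hinj : Function.Injective (algebraMap (PowerSeries k) D) := by
    rw [RingHom.injective_iff_ker_eq_bot]
    -- A nonzero prime of `k⟦X⟧` is maximal, hence contains `X`.
    by_contra hne
    have hmax := ((RingHom.ker_isPrime (algebraMap (PowerSeries k) D)).isMaximal hne)
    have := IsLocalRing.eq_maximalIdeal hmax
    rw [maximalIdeal_eq_span_X] at this
    exact hX (by rw [← RingHom.mem_ker, this]; exact Ideal.mem_span_singleton_self _)
  have : FaithfulSMul (PowerSeries k) D := (faithfulSMul_iff_algebraMap_injective _ _).2 hinj
  let K := FractionRing (PowerSeries k)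
  let L := FractionRing D
  have hinjL : Function.Injective (algebraMap (PowerSeries k) L) := by
    rw [IsScalarTower.algebraMap_eq (PowerSeries k) D L]
    exact (IsFractionRing.injective D L).comp hinj
  have : FaithfulSMul (PowerSeries k) L := (faithfulSMul_iff_algebraMap_injective _ _).2 hinjL
  let : Algebra K L := FractionRing.liftAlgebra (PowerSeries k) L
  have : FiniteDimensional K L := .of_isLocalization (PowerSeries k) D
    (nonZeroDivisors (PowerSeries k))
  -- Characteristic zero makes `L` separable over `K`, as needed for the integral closure to be
  -- Dedekind.
  have : CharZero (PowerSeries k) :=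
    charZero_of_injective_algebraMap (FaithfulSMul.algebraMap_injective k (PowerSeries k))
  have : CharZero K :=
    charZero_of_injective_algebraMap (IsFractionRing.injective (PowerSeries k) K)
  let B := integralClosure (PowerSeries k) L
  have : IsDedekindDomain B := integralClosure.isDedekindDomain (PowerSeries k) K L
  let ι : D →ₐ[k] B :=
    ((IsScalarTower.toAlgHom k D L).codRestrict (B.restrictScalars k) fun d =>
      (Algebra.IsIntegral.isIntegral (R := PowerSeries k) d).map
        (IsScalarTower.toAlgHom (PowerSeries k) D L))
  have hι : ι (algebraMap (PowerSeries k) D X) = algebraMap (PowerSeries k) B X := by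
    apply Subtype.ext
    change algebraMap D L (algebraMap (PowerSeries k) D X) = algebraMap (PowerSeries k) L X
    rw [← IsScalarTower.algebraMap_apply]
  have hXB : algebraMap (PowerSeries k) B X ≠ 0 := by
    intro h
    apply X_ne_zero (R := k)
    apply hinjL
    rw [map_zero]
    exact congrArg Subtype.val h
  obtain ⟨φ, h1, h2⟩ := exists_branch_of_isDedekindDomain hXB
  exact ⟨φ.comp ι, by rwa [AlgHom.comp_apply, hι], by rwa [AlgHom.comp_apply, hι]⟩

/-! ### Curve selection -/

/-- Noetherianity supplies a maximal `P`. It is prime because powers of `m` inside `P + (a)` and `P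
+ (b)` multiply to one inside `P + (ab)`. -/
theorem Ideal.exists_isPrime_maximal_not_pow_le {R : Type*} [CommRing R] [IsNoetherianRing R]
    {m I : Ideal R} (h : ∀ N, ¬ m ^ N ≤ I) :
    ∃ P : Ideal R, I ≤ P ∧ P.IsPrime ∧ (∀ N, ¬ m ^ N ≤ P) ∧ ∀ Q, P < Q → ∃ N, m ^ N ≤ Q := by
  obtain ⟨P, ⟨hIP, hP⟩, hmax⟩ := set_has_maximal_iff_noetherian.2 ‹IsNoetherianRing R›
    {P : Ideal R | I ≤ P ∧ ∀ N, ¬ m ^ N ≤ P} ⟨I, le_rfl, h⟩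
  have hmax' : ∀ Q, P < Q → ∃ N, m ^ N ≤ Q := by
    intro Q hQ
    by_contra! hN
    exact hmax Q ⟨hIP.trans hQ.le, hN⟩ hQ
  refine ⟨P, hIP, ⟨?_, ?_⟩, hP, hmax'⟩
  · rintro rfl
    exact hP 0 le_top
  · intro a b hab
    by_contra! hne
    have hlt : ∀ c ∉ P, ∃ N, m ^ N ≤ P ⊔ Ideal.span {c} := by
      intro c hc
      refine hmax' _ (lt_of_le_of_ne le_sup_left fun heq => hc ?_)
      rw [heq]
      exact Ideal.mem_sup_right (Ideal.mem_span_singleton_self c)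
    obtain ⟨N₁, h₁⟩ := hlt a hne.1
    obtain ⟨N₂, h₂⟩ := hlt b hne.2
    apply hP (N₁ + N₂)
    rw [pow_add]
    refine (Ideal.mul_mono h₁ h₂).trans ?_
    rw [Ideal.sup_mul, Ideal.mul_sup, Ideal.mul_sup, Ideal.span_singleton_mul_span_singleton]
    refine sup_le (sup_le Ideal.mul_le_right Ideal.mul_le_left) (sup_le Ideal.mul_le_right ?_)
    rwa [Ideal.span_singleton_le_iff_mem]

theorem MvPowerSeries.finite_quotient_of_pow_le {σ k : Type*} [Finite σ] [CommRing k]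
    {I : Ideal (MvPowerSeries σ k)} {N : ℕ}
    (h : Ideal.span (Set.range (X : σ → MvPowerSeries σ k)) ^ N ≤ I) :
    Module.Finite k (MvPowerSeries σ k ⧸ I) := by
  classical
  have : Fintype {d : σ →₀ ℕ // d.degree < N} := (Finsupp.finite_of_degree_lt N).fintype
  refine Module.Finite.of_surjective (Fintype.linearCombination k
    fun d : {d : σ →₀ ℕ // d.degree < N} => Ideal.Quotient.mkₐ k I (monomial d.1 1)) fun x => ?_
  obtain ⟨f, rfl⟩ := Ideal.Quotient.mkₐ_surjective k I x
  refine ⟨fun d => coeff d.1 f, ?_⟩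
  simp only [Fintype.linearCombination_apply, ← map_smul, ← map_sum]
  refine (Ideal.Quotient.eq.2 (h (mem_span_X_pow N _ fun d hd => ?_))).symm
  rw [map_sub, map_sum, sub_eq_zero, Finset.sum_eq_single ⟨d, hd⟩]
  · simp
  · intro e _ he
    have : d ≠ e.1 := fun h => he (Subtype.ext h.symm)
    simp [coeff_monomial, this]
  · simp

/-- A separated module over `k⟦X⟧` that is finite modulo `X` is finite; here for algebras. -/
theorem PowerSeries.finite_of_forall_dvd_sub {k D ι : Type*} [CommRing k] [CommRing D] [Algebra k D]
    [Algebra (PowerSeries k) D] [IsScalarTower k (PowerSeries k) D] [Fintype ι]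
    (hsep : ∀ d : D, (∀ N, algebraMap (PowerSeries k) D X ^ N ∣ d) → d = 0)
    (s : ι → D) (hs : ∀ d : D, ∃ c : ι → k, algebraMap (PowerSeries k) D X ∣ d - ∑ j, c j • s j) :
    Module.Finite (PowerSeries k) D := by
  choose c q hq using hs
  -- Divide by `X` repeatedly; the successive remainders are the coefficients of the expansion.
  let F : D → ι → PowerSeries k := fun d j => PowerSeries.mk fun N => c (q^[N] d) j
  have hF : ∀ d j, F d j = algebraMap k _ (c d j) + X * F (q d) j := by
    intro d j
    ext N
    cases N with
    | zero => simp [F]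
    | succ N => simp [F, coeff_succ_X_mul]
  have hstep : ∀ d, d - ∑ j, F d j • s j =
      algebraMap (PowerSeries k) D X * (q d - ∑ j, F (q d) j • s j) := by
    intro d
    have h1 : ∑ j, F d j • s j =
        ∑ j, c d j • s j + algebraMap (PowerSeries k) D X * ∑ j, F (q d) j • s j := by
      rw [Finset.mul_sum, ← Finset.sum_add_distrib]
      refine Finset.sum_congr rfl fun j _ => ?_
      rw [hF, add_smul, algebraMap_smul, mul_smul, Algebra.smul_def X]
    rw [h1, mul_sub, ← hq]
    ring
  have hdvd : ∀ N d, algebraMap (PowerSeries k) D X ^ N ∣ d - ∑ j, F d j • s j := by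
    intro N
    induction N with
    | zero => simp
    | succ N ih =>
      intro d
      rw [hstep, pow_succ']
      exact mul_dvd_mul_left _ (ih _)
  refine Module.Finite.of_surjective (Fintype.linearCombination (PowerSeries k) s) fun d => ?_
  exact ⟨F d, (sub_eq_zero.1 (hsep _ fun N => hdvd N d)).symm⟩

/-- Curve selection: an ideal of `k⟦x₁, …, xₙ⟧` that contains no power of the maximal ideal vanishes
on some nonconstant formal curve. -/
theorem MvPowerSeries.exists_curve {σ k : Type*} [Finite σ] [Field k] [IsAlgClosed k] [CharZero k]
    {I : Ideal (MvPowerSeries σ k)}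
    (hI : ∀ N, ¬ Ideal.span (Set.range (X : σ → MvPowerSeries σ k)) ^ N ≤ I) :
    ∃ φ : MvPowerSeries σ k →ₐ[k] PowerSeries k,
      (∀ i, PowerSeries.constantCoeff (φ (X i)) = 0) ∧ (∃ i, φ (X i) ≠ 0) ∧
        ∀ f ∈ I, φ f = 0 := by
  obtain ⟨P, hIP, hPprime, hP, hmax⟩ := Ideal.exists_isPrime_maximal_not_pow_le hI
  obtain ⟨i, hi⟩ : ∃ i, X i ∉ P := by
    by_contra! h
    apply hP 1
    rw [pow_one, Ideal.span_le]
    rintro _ ⟨i, rfl⟩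
    exact h i
  let ι : PowerSeries k →ₐ[k] MvPowerSeries σ k :=
    PowerSeries.substAlgHom (PowerSeries.HasSubst.X i)
  have hι : ι PowerSeries.X = X i := PowerSeries.substAlgHom_X _
  let D := MvPowerSeries σ k ⧸ P
  let mk : MvPowerSeries σ k →ₐ[k] D := Ideal.Quotient.mkₐ k P
  have hmk : ∀ f, mk f = 0 ↔ f ∈ P := fun f => Ideal.Quotient.eq_zero_iff_mem
  have hsurj : Function.Surjective mk := Ideal.Quotient.mk_surjective
  let : Algebra (PowerSeries k) D := (mk.comp ι).toRingHom.toAlgebra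
  have : IsScalarTower k (PowerSeries k) D :=
    .of_algebraMap_eq fun c => ((mk.comp ι).commutes c).symm
  have ht : algebraMap (PowerSeries k) D PowerSeries.X = mk (X i) := congrArg mk hι
  have hsep : ∀ d : D, (∀ N, mk (X i) ^ N ∣ d) → d = 0 := by
    -- `Q` is the `X i`-adic closure of `P`. Were it larger, it would contain some `X i ^ N`, so `X
    -- i ^ N * (1 - X i * a) ∈ P` with a unit as second factor, forcing `X i ∈ P`.
    let Q : Ideal (MvPowerSeries σ k) := ⨅ N, P ⊔ Ideal.span {X i ^ N}
    have hQ : ∀ f, f ∈ Q ↔ ∀ N, mk (X i) ^ N ∣ mk f := by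
      intro f
      rw [Submodule.mem_iInf]
      refine forall_congr' fun N => ?_
      rw [Submodule.mem_sup]
      constructor
      · rintro ⟨p, hp, q, hq, rfl⟩
        obtain ⟨a, rfl⟩ := Ideal.mem_span_singleton.1 hq
        rw [map_add, (hmk p).2 hp, zero_add, map_mul, map_pow]
        exact dvd_mul_right _ _
      · rintro ⟨d, hd⟩
        obtain ⟨a, rfl⟩ := hsurj d
        refine ⟨f - X i ^ N * a, ?_, X i ^ N * a,
          Ideal.mem_span_singleton.2 (dvd_mul_right _ _), by ring⟩
        rw [← hmk, map_sub, map_mul, map_pow, hd, sub_self]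
    have hPQ : P ≤ Q := le_iInf fun N => le_sup_left
    intro d hd
    obtain ⟨f, rfl⟩ := hsurj d
    rw [hmk]
    by_contra hf
    obtain ⟨N, hN⟩ := hmax Q (lt_of_le_of_ne hPQ fun h => hf (h ▸ (hQ f).2 hd))
    have hXN : X i ^ N ∈ Q := hN (Ideal.pow_mem_pow (Ideal.subset_span (Set.mem_range_self i)) N)
    obtain ⟨d, hd⟩ := (hQ _).1 hXN (N + 1)
    obtain ⟨a, rfl⟩ := hsurj d
    have h0 : X i ^ N * (1 - X i * a) ∈ P := by
      rw [← hmk, map_mul, map_sub, map_mul, map_one, mul_sub, ← mul_assoc, ← map_mul,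
        mul_one, hd]
      simp only [map_mul, map_pow]
      ring
    rcases hPprime.mem_or_mem h0 with h1 | h1
    · exact hi (hPprime.mem_of_pow_mem N h1)
    · refine hPprime.ne_top (Ideal.eq_top_of_isUnit_mem _ h1 ?_)
      rw [isUnit_iff_constantCoeff]
      simp
  have hlt : P < P ⊔ Ideal.span {X i} := lt_of_le_of_ne le_sup_left fun heq =>
    hi (heq ▸ Ideal.mem_sup_right (Ideal.mem_span_singleton_self (X i)))
  obtain ⟨N, hN⟩ := hmax _ hlt
  have hXdvd : ∀ f ∈ Ideal.span (Set.range (X : σ → MvPowerSeries σ k)) ^ N,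
      mk (X i) ∣ mk f := by
    intro f hf
    obtain ⟨p, hp, q, hq, rfl⟩ := Submodule.mem_sup.1 (hN hf)
    rw [map_add, (hmk p).2 hp, zero_add]
    exact map_dvd mk (Ideal.mem_span_singleton.1 hq)
  have : Module.Finite k
      (MvPowerSeries σ k ⧸ Ideal.span (Set.range (X : σ → MvPowerSeries σ k)) ^ N) :=
    finite_quotient_of_pow_le le_rfl
  obtain ⟨n, s, hs⟩ := Module.Finite.exists_fin (R := k)
    (M := MvPowerSeries σ k ⧸ Ideal.span (Set.range (X : σ → MvPowerSeries σ k)) ^ N)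
  choose g hg using fun j => Ideal.Quotient.mkₐ_surjective k _ (s j)
  have : Module.Finite (PowerSeries k) D := by
    refine PowerSeries.finite_of_forall_dvd_sub (by rwa [ht]) (fun j => mk (g j)) fun d => ?_
    obtain ⟨f, rfl⟩ := hsurj d
    obtain ⟨c, hc⟩ := (Submodule.mem_span_range_iff_exists_fun k).1
      (hs ▸ Submodule.mem_top : Ideal.Quotient.mkₐ k _ f ∈ Submodule.span k (Set.range s))
    refine ⟨c, ?_⟩
    simp only [ht, ← map_smul, ← map_sum, ← map_sub]
    apply hXdvd
    rw [← Ideal.Quotient.eq_zero_iff_mem, ← Ideal.Quotient.mkₐ_eq_mk k, map_sub, sub_eq_zero, ← hc]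
    simp [← hg]
  obtain ⟨φ, hφ, hφ0⟩ := PowerSeries.exists_branch (k := k) (D := D)
    (by rwa [ht, Ne, hmk])
  rw [ht] at hφ hφ0
  refine ⟨φ.comp mk, fun j => ?_, ⟨i, hφ⟩, fun f hf => ?_⟩
  -- `X i` divides `X j ^ N` modulo `P`, so the constant term of the image of `X j` is nilpotent.
  · have h1 := map_dvd ((PowerSeries.constantCoeff (R := k)).comp φ.toRingHom)
      (hXdvd (X j ^ N) (Ideal.pow_mem_pow (Ideal.subset_span (Set.mem_range_self j)) N))
    have h2 : PowerSeries.constantCoeff (φ (mk (X j))) ^ N = 0 := by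
      rw [← zero_dvd_iff, ← hφ0]
      simpa using h1
    exact eq_zero_of_pow_eq_zero h2
  · rw [AlgHom.comp_apply, (hmk f).2 (hIP hf), map_zero]

/-- A power series with zero constant term that is algebraic over the base field is zero. -/
theorem PowerSeries.eq_zero_of_isAlgebraic {k : Type*} [Field k] {f : PowerSeries k}
    (hf : constantCoeff f = 0) (halg : IsAlgebraic k f) : f = 0 := by
  by_contra hne
  have hint := halg.isIntegral
  have hu : IsField (Algebra.adjoin k {f}) := by
    have := Algebra.IsIntegral.adjoin (R := k) (S := {f}) (by simpa using hint)
    exact isField_of_isIntegral_of_isField' (R := k) (Field.toIsField k)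
  obtain ⟨g, hg⟩ := hu.mul_inv_cancel (a := ⟨f, Algebra.self_mem_adjoin_singleton k f⟩)
    (fun h => hne (congrArg Subtype.val h))
  have h1 : f * g.1 = 1 := congrArg Subtype.val hg
  simpa [hf] using congrArg constantCoeff h1

theorem lemma3p32 (n r : ℕ) (K : Fin r → MvPowerSeries (Fin n) ℂ) :
    (¬ FiniteDimensional ℂ (MvPowerSeries (Fin n) ℂ ⧸ Ideal.span (Set.range K))) ↔
      ∃ μ : Fin n → PowerSeries ℂ,
        (∀ i, PowerSeries.constantCoeff (μ i) = 0) ∧ μ ≠ 0 ∧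
          ∀ j, formalComp (K j) μ = 0 := by
  constructor
  · intro h
    obtain ⟨φ, h0, ⟨i, hi⟩, hI⟩ := MvPowerSeries.exists_curve (I := Ideal.span (Set.range K))
      fun N hN => h (MvPowerSeries.finite_quotient_of_pow_le hN)
    refine ⟨fun i => φ (MvPowerSeries.X i), h0, fun h => hi (congrFun h i), fun j => ?_⟩
    have hs : MvPowerSeries.HasSubst (S := ℂ) fun i => φ (MvPowerSeries.X i) :=
      MvPowerSeries.hasSubst_of_constantCoeff_zero h0
    -- The abstract homomorphism is substitution of the images of the variables.
    have heq : φ = MvPowerSeries.substAlgHom hs :=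
      MvPowerSeries.algHom_powerSeries_ext h0 fun i =>
        (MvPowerSeries.substAlgHom_X (R := ℂ) hs i).symm
    rw [← hI (K j) (Ideal.subset_span ⟨j, rfl⟩), formalComp,
      ← MvPowerSeries.substAlgHom_apply hs, ← heq]
  · rintro ⟨μ, h0, hne, hK⟩ hfin
    have hs : MvPowerSeries.HasSubst μ := MvPowerSeries.hasSubst_of_constantCoeff_zero h0
    let φ : MvPowerSeries (Fin n) ℂ →ₐ[ℂ] PowerSeries ℂ := MvPowerSeries.substAlgHom hs
    have hker : ∀ f ∈ Ideal.span (Set.range K), φ f = 0 := by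
      have : Ideal.span (Set.range K) ≤ RingHom.ker φ := by
        rw [Ideal.span_le]
        rintro _ ⟨j, rfl⟩
        exact (MvPowerSeries.substAlgHom_apply hs (K j)).trans (hK j)
      exact this
    let ψ := Ideal.Quotient.liftₐ (Ideal.span (Set.range K)) φ hker
    refine hne (funext fun i => PowerSeries.eq_zero_of_isAlgebraic (h0 i) ?_)
    have hψ : ψ (Ideal.Quotient.mk _ (MvPowerSeries.X i)) = μ i :=
      MvPowerSeries.substAlgHom_X hs i
    rw [← hψ]
    exact (Algebra.IsAlgebraic.isAlgebraic (R := ℂ) _).algHom ψ
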